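/- All graphs are finite and simple, and $\delta(G)$ is the minimum degree of $G$. The augmented cubes $AQ_n$ are defined recursively: $AQ_1=K_2$ on the vertices $0$ and $1$; for $n\ge 2$, $AQ_n$ has the binary strings of length $n$ as vertices, the strings beginning with $0$ and those beginning with $1$ each induce a copy of $AQ_{n-1}$ (on the remaining $n-1$ digits), and $0u$ and $1v$ are adjacent if and only if $u=v$ or $u$ and $v$ differ in every position. Up to isomorphism, let $\mathcal{GAQ}_4=\{AQ_4\}$ and, for $n\ge 5$, let $\mathcal{GAQ}_n$ consist of all graphs $(V_1\cup V_2,\,E_1\cup E_2\cup M_1\cup M_2)$, where $G_1=(V_1,E_1)$ and $G_2=(V_2,E_2)$ are vertex-disjoint copies of two (not necessarily distinct) graphs in $\mathcal{GAQ}_{n-1}$ and $M_1,M_2$ are edge-disjoint perfect matchings between $V_1$ and $V_2$. A fractional perfect matching of a graph $G$ is a function $f:E(G)\to[0,1]$ such that, for every vertex $v$, the values of $f$ on the edges incident with $v$ sum to $1$. The fractional strong matching preclusion number $fsmp(G)$ is the minimum size of a set $F\subseteq V(G)\cup E(G)$ such that $G-F$ has no fractional perfect matching. The graph $G$ is fractional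 strongly maximally matched if $fsmp(G)=\delta(G)$. **Theorem 3.2.** Let $n\ge 5$. If every graph in $\mathcal{GAQ}_{n-1}$ has fractional strong matching preclusion number $2n-3$, then every graph $G$ in $\mathcal{GAQ}_n$ has fractional strong matching preclusion number $2n-1$; moreover $2n-1=\delta(G)$, that is, $G$ is fractional strongly maximally matched. -/

import Mathlib

universe u

namespace AugCube

/-- The augmented cube `AQ_n` on the binary strings of length `n`, by recursion on `n`: two copies
of the previous cube (strings starting with `false`, strings starting with `true`), each string of
one copy being joined to the string with the same tail and to the string with the complementary
tail in the other copy. (`AQ_0` is a single vertex, so that `AQ_1` is `K_2`.) -/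
def augmentedCube : (n : ℕ) → SimpleGraph (Fin n → Bool)
  | 0 => ⊥
  | n + 1 =>
    { Adj := fun u v =>
        (u 0 = v 0 ∧ (augmentedCube n).Adj (Fin.tail u) (Fin.tail v)) ∨
        (u 0 ≠ v 0 ∧ (Fin.tail u = Fin.tail v ∨ ∀ i, Fin.tail u i ≠ Fin.tail v i))
      symm := ⟨by
        rintro u v (⟨h, h'⟩ | ⟨h, h' | h'⟩)
        · exact Or.inl ⟨h.symm, h'.symm⟩
        · exact Or.inr ⟨h.symm, Or.inl h'.symm⟩
        · exact Or.inr ⟨h.symm, Or.inr fun i => (h' i).symm⟩⟩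
      loopless := ⟨by
        rintro u (⟨_, h⟩ | ⟨h, _⟩)
        · exact (augmentedCube n).loopless.irrefl _ h
        · exact h rfl⟩ }

/-- The graph `(V₁ ∪ V₂, E₁ ∪ E₂ ∪ M₁ ∪ M₂)` on the disjoint union of the vertex sets of `G₁` and
`G₂`, where `M₁`, `M₂` are the perfect matchings between `V₁` and `V₂` formed by the edges
`{v, σ v}`, respectively `{v, τ v}`, for `v` in `V₁`. -/
def twoMatchingJoin {V₁ V₂ : Type u} (G₁ : SimpleGraph V₁) (G₂ : SimpleGraph V₂)
    (σ τ : V₁ ≃ V₂) : SimpleGraph (V₁ ⊕ V₂) where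
  Adj
    | Sum.inl a, Sum.inl b => G₁.Adj a b
    | Sum.inr a, Sum.inr b => G₂.Adj a b
    | Sum.inl a, Sum.inr b => σ a = b ∨ τ a = b
    | Sum.inr b, Sum.inl a => σ a = b ∨ τ a = b
  symm := ⟨by
    rintro (a | a) (b | b) h
    · exact G₁.adj_symm h
    · exact h
    · exact h
    · exact G₂.adj_symm h⟩
  loopless := ⟨by
    rintro (a | a) h
    · exact G₁.loopless.irrefl a h
    · exact G₂.loopless.irrefl a h⟩

/-- `IsGAQ n G`: the graph `G` belongs, up to isomorphism, to the class of `n`-dimensional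
generalized augmented cubes. There are none for `n < 4`, the only one for `n = 4` is `AQ_4`, and
those of dimension `n + 1` are obtained from two, possibly isomorphic, of dimension `n` by adding
two edge-disjoint perfect matchings between their vertex sets. -/
inductive IsGAQ : ℕ → ∀ {V : Type u}, SimpleGraph V → Prop
  | base {V : Type u} {G : SimpleGraph V} (e : augmentedCube 4 ≃g G) : IsGAQ 4 G
  | step {n : ℕ} {V₁ V₂ V : Type u} {G₁ : SimpleGraph V₁} {G₂ : SimpleGraph V₂}
      {G : SimpleGraph V} (h₁ : IsGAQ n G₁) (h₂ : IsGAQ n G₂) (σ τ : V₁ ≃ V₂)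
      (disjoint : ∀ v, σ v ≠ τ v) (e : twoMatchingJoin G₁ G₂ σ τ ≃g G) : IsGAQ (n + 1) G

open Classical in
/-- `f` is a fractional perfect matching of `G`: the edges get values in `[0, 1]` and the values of
the edges incident with any given vertex sum to `1`. (Values of `f` off the edges of `G` play no
role.) -/
def IsFractionalPerfectMatching {V : Type u} [Fintype V] (G : SimpleGraph V)
    (f : Sym2 V → ℝ) : Prop :=
  (∀ e ∈ G.edgeSet, f e ∈ Set.Icc (0 : ℝ) 1) ∧ ∀ v, ∑ e ∈ G.incidenceFinset v, f e = 1

/-- The graph `G - F`, where `F` consists of the vertices in `S` and the edges in `T`. -/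
def deleteVertsEdges {V : Type u} (G : SimpleGraph V) (S : Finset V) (T : Finset (Sym2 V)) :
    SimpleGraph {v : V // v ∉ S} :=
  (G.deleteEdges (T : Set (Sym2 V))).comap Subtype.val

open Classical in
/-- The set `F` consisting of the vertices in `S` and the edges in `T` is a fractional strong
matching preclusion set of `G`: the graph `G - F` has no fractional perfect matching. -/
def IsFSMPSet {V : Type u} [Fintype V] (G : SimpleGraph V) (S : Finset V)
    (T : Finset (Sym2 V)) : Prop :=
  (T : Set (Sym2 V)) ⊆ G.edgeSet ∧
    ¬ ∃ f : Sym2 {v : V // v ∉ S} → ℝ, IsFractionalPerfectMatching (deleteVertsEdges G S T) f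

/-- The fractional strong matching preclusion number: the minimum size of a fractional strong
matching preclusion set. (Every graph with at least one vertex has such a set: the edges at a
vertex.) -/
noncomputable def fsmp {V : Type u} [Fintype V] (G : SimpleGraph V) : ℕ :=
  sInf {k : ℕ | ∃ (S : Finset V) (T : Finset (Sym2 V)), IsFSMPSet G S T ∧ S.card + T.card = k}

open Classical in
/-- `G` is fractional strongly maximally matched: `fsmp G` equals the minimum degree of `G`. -/
def IsFractionalStronglyMaximallyMatched {V : Type u} [Fintype V] (G : SimpleGraph V) : Prop :=
  fsmp G = G.minDegree

end AugCube

/-!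
By Hall's theorem a graph has a fractional perfect matching if and only if its vertices admit a
permutation `π` with `x` adjacent to `π x` for all `x` (`exists_isFractionalPerfectMatching_iff`):
summing over the vertices of a set `A` shows that `A` has at least `|A|` neighbours, and
conversely each arc `x → π x` gives weight `1/2` to its edge. So fractional perfect matchings
become disjoint covers by edges and directed cycles, which are preserved by disjoint unions and
easy to modify.

If a directed cycle loses the arc leaving `a`, the path that remains can be paired up along its
edges, after discarding its end `a` if its number of vertices is odd
(`HasEdgePerm.of_missing_arc`). Hence deleting one vertex from a coverable graph can be
compensated by giving up at most one further vertex, and deleting an edge by giving up some of its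
two ends.

Call a graph `k`-robust if it keeps a fractional perfect matching after any `k` or fewer
deletions. Joining two `k`-robust graphs, `4 ≤ k`, by two disjoint perfect matchings `σ` and `τ`
gives a `(k + 2)`-robust graph (`Robust.join`). Indeed, if at most `k` faults lie in each half,
the halves are covered separately. Otherwise one half has `k + j` faults with `j = 1` or `j = 2`,
and it can be covered after giving up a set `B` of at most `2 j` vertices. These are matched into
the other half by `σ` or by `τ`, and the rest of the other half, which has few faults, is still
covered. For `j = 2` there are no other faults. For `j = 1` there is at most one other fault; it
can obstruct both `σ` and `τ` only if it is a vertex `w` and `B` contains both partners `p`, `q`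
of `w`, and this is avoided by choosing well the deleted element whose loss is compensated: a
vertex if there is one, and otherwise an edge different from `pq`
(`Robust.exists_repair_avoiding`).

With `k = 2 n - 4` this gives `fsmp G ≥ 2 n - 1`. The graphs of the class are `(2 n - 1)`-regular,
and deleting all edges at one vertex gives the reverse inequality.
-/

namespace AugCube

open Equiv

/-! ### Coverings by edges and directed cycles -/

section EdgePerm

variable {V : Type u}

/-- The vertices in `A` can be covered by disjoint edges and cycles of `K` inside `A`, encoded as a
permutation `π` that moves every vertex of `A` along an edge of `K` and fixes all other vertices. It
follows that `π` preserves `A`; a 2-cycle of `π` stands for a single edge. -/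
def HasEdgePerm (K : SimpleGraph V) (A : Set V) : Prop :=
  ∃ π : Perm V, (∀ x ∈ A, K.Adj x (π x)) ∧ ∀ x ∉ A, π x = x

theorem HasEdgePerm.mono {K L : SimpleGraph V} {A : Set V} (h : HasEdgePerm K A)
    (hKL : K ≤ L) : HasEdgePerm L A := by
  obtain ⟨π, hπ, hfix⟩ := h
  exact ⟨π, fun x hx => hKL (hπ x hx), hfix⟩

theorem HasEdgePerm.map {W : Type u} {K : SimpleGraph V} {L : SimpleGraph W} {A : Set V}
    {B : Set W} (h : HasEdgePerm K A) (e : V ≃ W) (hB : ∀ x, e x ∈ B ↔ x ∈ A)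
    (hadj : ∀ x y, K.Adj x y → L.Adj (e x) (e y)) : HasEdgePerm L B := by
  obtain ⟨π, hπ, hfix⟩ := h
  refine ⟨e.permCongr π, fun x hx => ?_, fun x hx => ?_⟩
  · obtain ⟨y, rfl⟩ := e.surjective x
    simpa using hadj _ _ (hπ y ((hB y).1 hx))
  · obtain ⟨y, rfl⟩ := e.surjective x
    simp [hfix y (mt (hB y).2 hx)]

theorem HasEdgePerm.union {K : SimpleGraph V} {A B : Set V} (hA : HasEdgePerm K A)
    (hB : HasEdgePerm K B) (hAB : Disjoint A B) : HasEdgePerm K (A ∪ B) := by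
  obtain ⟨π, hπ, hπ'⟩ := hA
  obtain ⟨θ, hθ, hθ'⟩ := hB
  refine ⟨π * θ, ?_, ?_⟩
  · rintro x (hx | hx)
    · rw [Perm.mul_apply, hθ' x (Set.disjoint_left.1 hAB hx)]
      exact hπ x hx
    · have h : θ x ∈ B := by
        by_contra h
        exact (hθ x hx).ne (θ.injective (hθ' _ h)).symm
      rw [Perm.mul_apply, hπ' _ (Set.disjoint_right.1 hAB h)]
      exact hθ x hx
  · intro x hx
    rw [Set.mem_union, not_or] at hx
    rw [Perm.mul_apply, hθ' x hx.2, hπ' x hx.1]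

theorem HasEdgePerm.pair {K : SimpleGraph V} {a b : V} (h : K.Adj a b) :
    HasEdgePerm K {a, b} := by
  classical
  refine ⟨swap a b, ?_, ?_⟩
  · rintro x (rfl | rfl)
    · simpa using h
    · simpa using h.symm
  · intro x hx
    simp only [Set.mem_insert_iff, Set.mem_singleton_iff, not_or] at hx
    exact swap_apply_of_ne_of_ne hx.1 hx.2

open Classical in
/-- The permutation `π` with `v` taken out of its cycle: `v` becomes a fixed point and the
predecessor of `v` is sent to `π v`. -/
noncomputable def erasePoint (π : Perm V) (v : V) : Perm V := swap v (π v) * π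

@[simp]
theorem erasePoint_self (π : Perm V) (v : V) : erasePoint π v v = v := by
  simp [erasePoint]

theorem erasePoint_of_ne {π : Perm V} {v x : V} (hx : x ≠ v) (h : π x ≠ v) :
    erasePoint π v x = π x := by
  classical
  rw [erasePoint, Perm.mul_apply]
  exact swap_apply_of_ne_of_ne h (π.injective.ne hx)

theorem erasePoint_of_fixed {π : Perm V} {v x : V} (h : π x = x) : erasePoint π v x = x := by
  by_cases hx : x = v
  · subst hx; simp
  · rw [erasePoint_of_ne hx (by rwa [h]), h]

/-- If `π` moves along edges all vertices of `A` except possibly `a`, then `A` or `A \ {a}` is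
coverable. The cycle of `a` without the arc leaving `a` is a path ending in `a`, which is paired
up from that end, two vertices at a time; if its number of vertices is odd, all pairs are shifted
by one and `a` is left out. -/
theorem HasEdgePerm.of_missing_arc [Finite V] {K : SimpleGraph V} {A : Set V} (π : Perm V) {a : V}
    (ha : a ∈ A) (hπ : ∀ x ∈ A, x ≠ a → K.Adj x (π x)) (hfix : ∀ x ∉ A, π x = x) :
    HasEdgePerm K A ∨ HasEdgePerm K (A \ {a}) := by
  induction hn : A.ncard using Nat.strong_induction_on generalizing A π a with
  | _ n ih =>
  by_cases h1 : π a = a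
  · refine Or.inr ⟨π, fun x hx => hπ x hx.1 hx.2, fun x hx => ?_⟩
    by_cases hxa : x = a
    · rwa [hxa]
    · exact hfix x fun h => hx ⟨h, hxa⟩
  obtain ⟨b, hb⟩ := π.surjective a
  have hba : b ≠ a := by rintro rfl; exact h1 hb
  have hbA : b ∈ A := by
    by_contra h
    exact hba ((hfix b h).symm.trans hb)
  have hKba : K.Adj b a := by simpa [hb] using hπ b hbA hba
  -- the cycle of `a` is `(a b)`, and the edge `b a` serves in both directions
  by_cases h2 : π a = b
  · refine Or.inl ⟨π, fun x hx => ?_, hfix⟩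
    by_cases hxa : x = a
    · rw [hxa, h2]; exact hKba.symm
    · exact hπ x hx hxa
  -- the path ends in `c → b → a`; take out `a` and `b`, which makes `c` the end of the path
  obtain ⟨c, hc⟩ := π.surjective b
  have hca : c ≠ a := by rintro rfl; exact h2 hc
  have hcb : c ≠ b := by rintro rfl; exact hba (hc.symm.trans hb)
  have hcA : c ∈ A := by
    by_contra h
    exact hcb ((hfix c h).symm.trans hc)
  have hKcb : K.Adj c b := by simpa [hc] using hπ c hcA hca
  have hlt : (A \ {a, b}).ncard < n := by
    rw [← hn]
    exact Set.ncard_lt_ncard ⟨Set.sdiff_subset, fun h => (h ha).2 (by simp)⟩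
  have key := ih _ hlt (A := A \ {a, b}) (erasePoint (erasePoint π a) b) (a := c)
    ⟨hcA, by simp [hca, hcb]⟩ ?_ ?_ rfl
  · rcases key with h | h
    · left
      have := h.union (HasEdgePerm.pair hKba.symm) Set.disjoint_sdiff_left
      rwa [Set.sdiff_union_of_subset] at this
      rintro x (rfl | rfl) <;> assumption
    · right
      have := h.union (HasEdgePerm.pair hKcb) ?_
      · convert this using 1
        ext x
        simp only [Set.mem_sdiff, Set.mem_union, Set.mem_insert_iff, Set.mem_singleton_iff]
        grind
      · rw [Set.disjoint_left]
        rintro x ⟨⟨_, hx⟩, hx'⟩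
        simp only [Set.mem_insert_iff, Set.mem_singleton_iff] at *
        grind
  · rintro x ⟨hxA, hx⟩ hxc
    simp only [Set.mem_insert_iff, Set.mem_singleton_iff, not_or] at hx
    have e1 : erasePoint π a x = π x :=
      erasePoint_of_ne hx.1 fun h => hx.2 (π.injective (h.trans hb.symm))
    rw [erasePoint_of_ne hx.2 (by rw [e1]; exact fun h => hxc (π.injective (h.trans hc.symm))), e1]
    exact hπ x hxA hx.1
  · intro x hx
    by_cases hxA : x ∈ A
    · have : x = a ∨ x = b := by
        by_contra h
        exact hx ⟨hxA, h⟩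
      rcases this with rfl | rfl
      · exact erasePoint_of_fixed (by simp)
      · simp
    · exact erasePoint_of_fixed (erasePoint_of_fixed (hfix x hxA))

/-- The loss of a vertex `v` is compensated by giving up at most one more vertex, the predecessor
of `v` in its cycle. -/
theorem HasEdgePerm.deleteVert [Finite V] {K : SimpleGraph V} {A : Set V} (h : HasEdgePerm K A)
    (v : V) : ∃ B : Finset V, B.card ≤ 1 ∧ HasEdgePerm K ((A \ {v}) \ (B : Set V)) := by
  by_cases hv : v ∈ A
  swap
  · exact ⟨∅, by simp, by simpa [Set.sdiff_singleton_eq_self hv] using h⟩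
  obtain ⟨π, hπ, hfix⟩ := h
  obtain ⟨a, ha⟩ := π.surjective v
  have hav : a ≠ v := by
    rintro rfl
    exact (hπ a hv).ne ha.symm
  have haA : a ∈ A := by
    by_contra h
    exact hav ((hfix a h).symm.trans ha)
  have := HasEdgePerm.of_missing_arc (K := K) (A := A \ {v}) (erasePoint π v) (a := a)
    ⟨haA, hav⟩ ?_ ?_
  · rcases this with h | h
    · exact ⟨∅, by simp, by simpa using h⟩
    · exact ⟨{a}, by simp, by simpa using h⟩
  · rintro x ⟨hx, hxv⟩ hxa
    rw [erasePoint_of_ne hxv fun h => hxa (π.injective (h.trans ha.symm))]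
    exact hπ x hx
  · intro x hx
    by_cases hxv : x = v
    · subst hxv; simp
    · exact erasePoint_of_fixed (hfix x fun h => hx ⟨h, hxv⟩)

/-- The loss of an edge is compensated by giving up some of its ends: none if the covering does not
use the edge, at most one if the edge is an arc of a longer cycle, both if it is a 2-cycle. -/
theorem HasEdgePerm.deleteEdge [Finite V] {K : SimpleGraph V} {A : Set V} (h : HasEdgePerm K A)
    (u v : V) : ∃ B : Set V, B ⊆ {u, v} ∧
      HasEdgePerm (K.deleteEdges {s(u, v)}) (A \ B) := by
  obtain ⟨π, hπ, hfix⟩ := h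
  -- the case in which the edge is traversed at most from `u` to `v`
  have one : ∀ u v, ¬ (v ∈ A ∧ π v = u) → ∃ B : Set V, B ⊆ {u, v} ∧
      HasEdgePerm (K.deleteEdges {s(u, v)}) (A \ B) := by
    intro u v huv
    by_cases hu : u ∈ A
    · have := HasEdgePerm.of_missing_arc (K := K.deleteEdges {s(u, v)}) (A := A) π hu ?_ hfix
      · rcases this with h | h
        · exact ⟨∅, by simp, by simpa using h⟩
        · exact ⟨{u}, by simp, h⟩
      · intro x hx hxu
        rw [SimpleGraph.deleteEdges_adj]
        refine ⟨hπ x hx, fun h => ?_⟩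
        rcases Sym2.eq_iff.1 h with ⟨h, _⟩ | ⟨h, h'⟩
        · exact hxu h
        · subst h; exact huv ⟨hx, h'⟩
    · refine ⟨∅, by simp, π, fun x hx => ?_, fun x hx => hfix x (by simpa using hx)⟩
      have hx : x ∈ A := by simpa using hx
      rw [SimpleGraph.deleteEdges_adj]
      refine ⟨hπ x hx, fun h => ?_⟩
      rcases Sym2.eq_iff.1 h with ⟨h, _⟩ | ⟨h, h'⟩
      · subst h; exact hu hx
      · subst h; exact huv ⟨hx, h'⟩
  by_cases h1 : v ∈ A ∧ π v = u
  swap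
  · exact one u v h1
  by_cases h2 : u ∈ A ∧ π u = v
  swap
  · obtain ⟨B, hB, h⟩ := one v u h2
    exact ⟨B, by rwa [Set.pair_comm], by rwa [Sym2.eq_swap]⟩
  refine ⟨{u, v}, subset_rfl, erasePoint (erasePoint π u) v, ?_, ?_⟩
  · rintro x ⟨hxA, hx⟩
    simp only [Set.mem_insert_iff, Set.mem_singleton_iff, not_or] at hx
    have hxu : π x ≠ u := fun h => hx.2 (π.injective (h.trans h1.2.symm))
    have hxv : π x ≠ v := fun h => hx.1 (π.injective (h.trans h2.2.symm))
    have e1 : erasePoint π u x = π x := erasePoint_of_ne hx.1 hxu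
    rw [erasePoint_of_ne hx.2 (by rwa [e1]), e1, SimpleGraph.deleteEdges_adj]
    refine ⟨hπ x hxA, fun h => ?_⟩
    rcases Sym2.eq_iff.1 h with ⟨h, _⟩ | ⟨h, _⟩
    · exact hx.1 h
    · exact hx.2 h
  · intro x hx
    by_cases hxA : x ∈ A
    · have : x = u ∨ x = v := by
        by_contra h
        exact hx ⟨hxA, h⟩
      rcases this with rfl | rfl
      · exact erasePoint_of_fixed (by simp)
      · simp
    · exact erasePoint_of_fixed (erasePoint_of_fixed (hfix x hxA))

end EdgePerm

/-! ### Fractional perfect matchings and permutations along edges -/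

open Classical in
theorem sum_incidenceFinset {V : Type u} [Fintype V] (H : SimpleGraph V) (f : Sym2 V → ℝ) (v : V) :
    ∑ e ∈ H.incidenceFinset v, f e = ∑ w ∈ H.neighborFinset v, f s(v, w) := by
  have : H.incidenceFinset v = (H.neighborFinset v).image fun w => s(v, w) := by
    ext e
    induction e with
    | _ a b =>
    simp only [SimpleGraph.mem_incidenceFinset, SimpleGraph.mk'_mem_incidenceSet_iff,
      Finset.mem_image, SimpleGraph.mem_neighborFinset, Sym2.eq_iff]
    constructor
    · rintro ⟨h, rfl | rfl⟩
      · exact ⟨b, h, by simp⟩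
      · exact ⟨a, h.symm, by simp⟩
    · rintro ⟨w, h, ⟨rfl, rfl⟩ | ⟨rfl, rfl⟩⟩
      · exact ⟨h, Or.inl rfl⟩
      · exact ⟨h.symm, Or.inr rfl⟩
  rw [this, Finset.sum_image]
  intro a _ b _ hab
  exact Sym2.congr_right.1 hab

open Classical in
/-- The weights certify the condition of Hall's theorem: the total weight `|A|` at a set `A` of
vertices lies on edges whose other ends are neighbours of `A`, and each neighbour carries weight at
most `1`. -/
theorem exists_edgePerm_of_isFractionalPerfectMatching {V : Type u} [Fintype V]
    {H : SimpleGraph V} {f : Sym2 V → ℝ} (hf : IsFractionalPerfectMatching H f) :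
    ∃ π : Perm V, ∀ x, H.Adj x (π x) := by
  obtain ⟨hf01, hf1⟩ := hf
  simp_rw [sum_incidenceFinset] at hf1
  have hall : ∀ A : Finset V, A.card ≤ (A.biUnion fun v => H.neighborFinset v).card := by
    intro A
    have h : (A.card : ℝ) ≤ ((A.biUnion fun v => H.neighborFinset v).card : ℝ) := by
      calc (A.card : ℝ) = ∑ v ∈ A, ∑ w ∈ H.neighborFinset v, f s(v, w) := by simp [hf1]
        _ = ∑ w ∈ A.biUnion fun v => H.neighborFinset v,
              ∑ v ∈ A.filter fun v => H.Adj w v, f s(w, v) := by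
            rw [Finset.sum_comm' (t' := A.biUnion fun v => H.neighborFinset v)
              (s' := fun w => A.filter fun v => H.Adj w v)]
            · simp_rw [Sym2.eq_swap]
            · intro v w
              simp only [SimpleGraph.mem_neighborFinset, Finset.mem_filter, Finset.mem_biUnion,
                H.adj_comm w v]
              exact ⟨fun h => ⟨h, v, h⟩, fun h => h.1⟩
        _ ≤ ∑ w ∈ A.biUnion fun v => H.neighborFinset v, (1 : ℝ) := by
            refine Finset.sum_le_sum fun w _ => ?_
            rw [← hf1 w]
            refine Finset.sum_le_sum_of_subset_of_nonneg ?_ ?_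
            · intro v hv
              simpa using (Finset.mem_filter.1 hv).2
            · intro v hv _
              exact (hf01 _ (by simpa using hv)).1
        _ = _ := by simp
    exact_mod_cast h
  obtain ⟨g, hg, hg'⟩ := (Finset.all_card_le_biUnion_card_iff_exists_injective _).1 hall
  exact ⟨Equiv.ofBijective g (Finite.injective_iff_bijective.1 hg), fun x => by
    simpa using hg' x⟩

open Classical in
theorem exists_isFractionalPerfectMatching_of_edgePerm {V : Type u} [Fintype V]
    {H : SimpleGraph V} (π : Perm V) (hπ : ∀ x, H.Adj x (π x)) :
    ∃ f : Sym2 V → ℝ, IsFractionalPerfectMatching H f := by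
  -- each vertex `x` puts weight `1 / 2` on `{x, π x}`; a vertex `v` thus receives `1 / 2` from
  -- `v` and `1 / 2` from its predecessor
  let f : Sym2 V → ℝ := fun e => ∑ x : V, if s(x, π x) = e then (1 / 2 : ℝ) else 0
  have hsum : ∀ v, ∑ e ∈ H.incidenceFinset v, f e = 1 := by
    intro v
    have hv : ∀ x, (∑ e ∈ H.incidenceFinset v, if s(x, π x) = e then (1 / 2 : ℝ) else 0) =
        (if v = x then 1 / 2 else 0) + if π.symm v = x then 1 / 2 else 0 := by
      intro x
      rw [Finset.sum_ite_eq]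
      have hmem : s(x, π x) ∈ H.incidenceFinset v ↔ v = x ∨ v = π x := by
        simp [SimpleGraph.mk'_mem_incidenceSet_iff, hπ x]
      have hne := (hπ x).ne
      by_cases h1 : v = x
      · have h2 : π.symm v ≠ x := by
          rw [Ne, Equiv.symm_apply_eq, h1]; exact hne
        rw [if_pos (hmem.2 (Or.inl h1)), if_pos h1, if_neg h2, add_zero]
      · rw [if_neg h1, zero_add]
        exact if_congr (by rw [hmem, Equiv.symm_apply_eq]; simp [h1]) rfl rfl
    simp only [f]
    rw [Finset.sum_comm]
    simp only [hv]
    rw [Finset.sum_add_distrib, Finset.sum_ite_eq, Finset.sum_ite_eq]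
    norm_num
  have hnonneg : ∀ e, 0 ≤ f e := fun e => Finset.sum_nonneg fun x _ => by split_ifs <;> norm_num
  refine ⟨f, fun e he => ⟨hnonneg e, ?_⟩, hsum⟩
  induction e with
  | _ a b =>
  rw [← hsum a]
  refine Finset.single_le_sum (f := f) (fun e _ => hnonneg e) ?_
  simpa [SimpleGraph.mk'_mem_incidenceSet_iff] using he

theorem exists_isFractionalPerfectMatching_iff {V : Type u} [Fintype V] (G : SimpleGraph V)
    (S : Finset V) (T : Finset (Sym2 V)) [Fintype {v : V // v ∉ S}] :
    (∃ f : Sym2 {v : V // v ∉ S} → ℝ,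
      IsFractionalPerfectMatching (deleteVertsEdges G S T) f) ↔
    HasEdgePerm (G.deleteEdges (T : Set (Sym2 V))) (S : Set V)ᶜ := by
  classical
  constructor
  · rintro ⟨f, hf⟩
    obtain ⟨π, hπ⟩ := exists_edgePerm_of_isFractionalPerfectMatching hf
    refine ⟨Perm.ofSubtype π, fun x hx => ?_, fun x hx => ?_⟩
    · rw [Perm.ofSubtype_apply_of_mem π (by simpa using hx)]
      exact hπ ⟨x, by simpa using hx⟩
    · exact Perm.ofSubtype_apply_of_not_mem π (by simpa using hx)
  · rintro ⟨π, hπ, hfix⟩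
    have hmem : ∀ x, π x ∉ S ↔ x ∉ S := by
      intro x
      by_cases hx : x ∈ S
      · rw [hfix x (by simpa using hx)]
      · refine iff_of_true (fun h => ?_) hx
        have h1 := π.injective (hfix (π x) (by simpa using h))
        exact hx (h1 ▸ h)
    exact exists_isFractionalPerfectMatching_of_edgePerm (π.subtypePerm hmem)
      fun x => hπ x.1 (by simp)

/-! ### Robust graphs and the repair of surplus faults -/

/-- `G` still has a fractional perfect matching, in the form of a permutation along edges, after the
deletion of any `k` or fewer vertices and edges. The elements of `T` are not required to be edges of
`G`. -/
def Robust {V : Type u} (G : SimpleGraph V) (k : ℕ) : Prop :=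
  ∀ (S : Finset V) (T : Finset (Sym2 V)), S.card + T.card ≤ k →
    HasEdgePerm (G.deleteEdges (T : Set (Sym2 V))) (S : Set V)ᶜ

theorem hasEdgePerm_iso {V W : Type u} {G : SimpleGraph V} {H : SimpleGraph W} (e : G ≃g H)
    {S : Finset W} {T : Finset (Sym2 W)}
    (h : HasEdgePerm
      (G.deleteEdges (T.preimage (Sym2.map e) (Sym2.map.injective e.injective).injOn :
        Set (Sym2 V)))
      (S.preimage e e.injective.injOn : Set V)ᶜ) :
    HasEdgePerm (H.deleteEdges (T : Set (Sym2 W))) (S : Set W)ᶜ := by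
  refine h.map e.toEquiv (fun x => by simp) fun x y hxy => ?_
  rw [SimpleGraph.deleteEdges_adj] at hxy ⊢
  exact ⟨e.map_adj_iff.2 hxy.1, fun h' => hxy.2 (by simpa using h')⟩

theorem Robust.map {V W : Type u} {G : SimpleGraph V} {H : SimpleGraph W} {k : ℕ}
    (h : Robust G k) (e : G ≃g H) : Robust H k := by
  classical
  intro S T hST
  refine hasEdgePerm_iso e (h _ _ ?_)
  rw [Finset.card_preimage, Finset.card_preimage]
  have h1 := Finset.card_filter_le S (· ∈ Set.range e)
  have h2 := Finset.card_filter_le T (· ∈ Set.range (Sym2.map e))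
  omega

/-- Adding the vertex `v` to the deleted vertices increases by at most one the number of vertices
that have to be given up. -/
theorem exists_repair_vert {V : Type u} [Finite V] [DecidableEq V] {G : SimpleGraph V}
    {S : Finset V} {T : Finset (Sym2 V)} {B : Finset V} {v : V} (hv : v ∈ S)
    (h : HasEdgePerm (G.deleteEdges (T : Set (Sym2 V))) ((S.erase v ∪ B : Finset V) : Set V)ᶜ) :
    ∃ C : Finset V, C.card ≤ B.card + 1 ∧
      HasEdgePerm (G.deleteEdges (T : Set (Sym2 V))) ((S ∪ C : Finset V) : Set V)ᶜ := by
  obtain ⟨C, hC, h'⟩ := h.deleteVert v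
  refine ⟨B ∪ C, (Finset.card_union_le _ _).trans (by omega), ?_⟩
  convert h' using 1
  ext x
  simp only [Set.mem_compl_iff, Finset.mem_coe, Finset.mem_union, Set.mem_sdiff,
    Finset.mem_erase, Set.mem_singleton_iff]
  grind

/-- After adding the edge `uv` to the deleted edges, only ends of that edge have to be given up in
addition. -/
theorem exists_repair_edge {V : Type u} [Finite V] [DecidableEq V] {G : SimpleGraph V}
    {S : Finset V} {T : Finset (Sym2 V)} {B : Finset V} {u v : V} (hv : s(u, v) ∈ T)
    (h : HasEdgePerm (G.deleteEdges ((T.erase s(u, v) : Finset _) : Set (Sym2 V)))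
      ((S ∪ B : Finset V) : Set V)ᶜ) :
    ∃ C : Finset V, C ⊆ {u, v} ∧
      HasEdgePerm (G.deleteEdges (T : Set (Sym2 V))) ((S ∪ (B ∪ C) : Finset V) : Set V)ᶜ := by
  classical
  obtain ⟨C, hC, h'⟩ := h.deleteEdge u v
  refine ⟨({u, v} : Finset V).filter (· ∈ C), Finset.filter_subset _ _, ?_⟩
  convert h' using 1
  · rw [SimpleGraph.deleteEdges_deleteEdges]
    congr 1
    ext e
    simp only [Finset.mem_coe, Finset.coe_erase, Set.mem_union, Set.mem_sdiff,
      Set.mem_singleton_iff]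
    grind
  · ext x
    have := @hC x
    simp only [Set.mem_compl_iff, Finset.mem_coe, Finset.mem_union, Set.mem_sdiff,
      Finset.mem_filter, Finset.mem_insert, Finset.mem_singleton, Set.mem_insert_iff,
      Set.mem_singleton_iff] at *
    grind

/-- If a `k`-robust graph suffers `k + j` deletions, what remains is coverable after giving up at
most `2 j` vertices. -/
theorem Robust.exists_repair {V : Type u} [Finite V] [DecidableEq V] {G : SimpleGraph V} {k : ℕ}
    (hG : Robust G k) (j : ℕ) (S : Finset V) (T : Finset (Sym2 V))
    (hST : S.card + T.card ≤ k + j) :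
    ∃ B : Finset V, B.card ≤ 2 * j ∧
      HasEdgePerm (G.deleteEdges (T : Set (Sym2 V))) ((S ∪ B : Finset V) : Set V)ᶜ := by
  induction j generalizing S T with
  | zero => exact ⟨∅, by simp, by simpa using hG S T hST⟩
  | succ j ih =>
    by_cases h0 : S.card + T.card ≤ k + j
    · obtain ⟨B, hB, h⟩ := ih S T h0
      exact ⟨B, by omega, h⟩
    rcases S.eq_empty_or_nonempty with hS | ⟨v, hv⟩
    · have hT : T.Nonempty := by
        rw [← Finset.card_pos]
        simp [hS] at h0
        omega
      obtain ⟨e, he⟩ := hT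
      induction e with
      | _ u v =>
      have := Finset.card_pos.2 ⟨_, he⟩
      obtain ⟨B, hB, h⟩ := ih S (T.erase s(u, v)) (by rw [Finset.card_erase_of_mem he]; omega)
      obtain ⟨C, hC, h'⟩ := exists_repair_edge he h
      refine ⟨B ∪ C, (Finset.card_union_le _ _).trans ?_, h'⟩
      have := (Finset.card_le_card hC).trans Finset.card_le_two
      omega
    · have := Finset.card_pos.2 ⟨v, hv⟩
      obtain ⟨B, hB, h⟩ := ih (S.erase v) T (by
        rw [Finset.card_erase_of_mem hv]; omega)
      obtain ⟨C, hC, h'⟩ := exists_repair_vert hv h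
      exact ⟨C, by omega, h'⟩

/-- With `k + 1` deletions, the at most two vertices to be given up can be chosen so that they do
not include both of two prescribed vertices `p` and `q`. -/
theorem Robust.exists_repair_avoiding {V : Type u} [Finite V] [DecidableEq V]
    {G : SimpleGraph V} {k : ℕ} (hG : Robust G k) (hk : 1 ≤ k) (S : Finset V)
    (T : Finset (Sym2 V)) (hST : S.card + T.card = k + 1) {p q : V} (hpq : p ≠ q) :
    ∃ B : Finset V, B.card ≤ 2 ∧ (p ∉ B ∨ q ∉ B) ∧
      HasEdgePerm (G.deleteEdges (T : Set (Sym2 V))) ((S ∪ B : Finset V) : Set V)ᶜ := by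
  rcases S.eq_empty_or_nonempty with hS | ⟨v, hv⟩
  -- some deleted edge differs from `pq`, and only ends of that edge are given up
  · have hT : 1 < T.card := by
      simp [hS] at hST
      omega
    obtain ⟨e, he, hne⟩ := Finset.exists_mem_ne hT s(p, q)
    induction e with
    | _ u v =>
    have h := hG S (T.erase s(u, v)) (by rw [Finset.card_erase_of_mem he]; omega)
    obtain ⟨C, hC, h'⟩ := exists_repair_edge (B := ∅) he (by simpa using h)
    refine ⟨C, (Finset.card_le_card hC).trans Finset.card_le_two, ?_, by simpa using h'⟩
    by_contra! hc
    have h1 := hC hc.1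
    have h2 := hC hc.2
    simp only [Finset.mem_insert, Finset.mem_singleton] at h1 h2
    apply hne
    rw [Sym2.eq_iff]
    grind
  -- compensating the loss of a vertex costs a single vertex
  · have := Finset.card_pos.2 ⟨v, hv⟩
    have h := hG (S.erase v) T (by rw [Finset.card_erase_of_mem hv]; omega)
    obtain ⟨C, hC, h'⟩ := exists_repair_vert (B := ∅) hv (by simpa using h)
    refine ⟨C, by simp at hC; omega, ?_, h'⟩
    by_contra! hc
    have := Finset.card_le_one.1 (by simpa using hC) p hc.1 q hc.2
    exact hpq this

/-! ### Two robust graphs joined by two perfect matchings -/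

section Join

variable {V₁ V₂ : Type u} {G₁ : SimpleGraph V₁} {G₂ : SimpleGraph V₂} {σ τ : V₁ ≃ V₂}

/-- The pairs in `T` inside the left summand. -/
noncomputable def leftEdges (T : Finset (Sym2 (V₁ ⊕ V₂))) : Finset (Sym2 V₁) :=
  T.preimage (Sym2.map Sum.inl) (Sym2.map.injective Sum.inl_injective).injOn

/-- The pairs in `T` inside the right summand. -/
noncomputable def rightEdges (T : Finset (Sym2 (V₁ ⊕ V₂))) : Finset (Sym2 V₂) :=
  T.preimage (Sym2.map Sum.inr) (Sym2.map.injective Sum.inr_injective).injOn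

open Classical in
/-- The pairs in `T` with one member in each summand. -/
noncomputable def crossEdges (T : Finset (Sym2 (V₁ ⊕ V₂))) : Finset (Sym2 (V₁ ⊕ V₂)) :=
  T.filter fun e => ∃ a b, e = s(Sum.inl a, Sum.inr b)

theorem mem_leftEdges {T : Finset (Sym2 (V₁ ⊕ V₂))} {a b : V₁} :
    s(a, b) ∈ leftEdges T ↔ s(Sum.inl a, Sum.inl b) ∈ T := by
  simp [leftEdges]

theorem mem_rightEdges {T : Finset (Sym2 (V₁ ⊕ V₂))} {a b : V₂} :
    s(a, b) ∈ rightEdges T ↔ s(Sum.inr a, Sum.inr b) ∈ T := by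
  simp [rightEdges]

theorem mem_crossEdges {T : Finset (Sym2 (V₁ ⊕ V₂))} {a : V₁} {b : V₂} :
    s(Sum.inl a, Sum.inr b) ∈ crossEdges T ↔ s(Sum.inl a, Sum.inr b) ∈ T := by
  simp [crossEdges]

theorem card_leftEdges_add (T : Finset (Sym2 (V₁ ⊕ V₂))) :
    (leftEdges T).card + (rightEdges T).card + (crossEdges T).card ≤ T.card := by
  classical
  rw [← Finset.card_image_of_injective (leftEdges T)
      (Sym2.map.injective (Sum.inl_injective (β := V₂))),
    ← Finset.card_image_of_injective (rightEdges T)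
      (Sym2.map.injective (Sum.inr_injective (α := V₁))),
    ← Finset.card_union_of_disjoint, ← Finset.card_union_of_disjoint]
  · refine Finset.card_le_card (Finset.union_subset (Finset.union_subset ?_ ?_)
      (Finset.filter_subset _ _))
    · intro e he
      obtain ⟨d, hd, rfl⟩ := Finset.mem_image.1 he
      simpa [leftEdges] using hd
    · intro e he
      obtain ⟨d, hd, rfl⟩ := Finset.mem_image.1 he
      simpa [rightEdges] using hd
  · rw [Finset.disjoint_right]
    intro e he he'
    obtain ⟨a, b, rfl⟩ := (Finset.mem_filter.1 he).2
    rcases Finset.mem_union.1 he' with h | h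
    · obtain ⟨d, _, h⟩ := Finset.mem_image.1 h
      induction d with
      | _ x y => simp at h
    · obtain ⟨d, _, h⟩ := Finset.mem_image.1 h
      induction d with
      | _ x y => simp at h
  · rw [Finset.disjoint_left]
    intro e he he'
    obtain ⟨d, _, rfl⟩ := Finset.mem_image.1 he
    obtain ⟨d', _, h⟩ := Finset.mem_image.1 he'
    induction d with
    | _ x y =>
    induction d' with
    | _ x' y' => simp at h

/-- A set `B` in the left summand together with its image under `ρ` is covered by the edges
`{b, ρ b}`. -/
theorem HasEdgePerm.cross {K : SimpleGraph (V₁ ⊕ V₂)} (ρ : V₁ ≃ V₂) (B : Set V₁)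
    (h : ∀ b ∈ B, K.Adj (Sum.inl b) (Sum.inr (ρ b))) :
    HasEdgePerm K (Sum.inl '' B ∪ Sum.inr '' (ρ '' B)) := by
  classical
  let θ : V₁ ⊕ V₂ → V₁ ⊕ V₂ := Sum.elim (fun a => if a ∈ B then Sum.inr (ρ a) else Sum.inl a)
    fun c => if ρ.symm c ∈ B then Sum.inl (ρ.symm c) else Sum.inr c
  have hθ : Function.Involutive θ := by
    rintro (a | c)
    · by_cases ha : a ∈ B <;> simp [θ, ha]
    · by_cases hc : ρ.symm c ∈ B <;> simp [θ, hc]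
  refine ⟨hθ.toPerm, ?_, ?_⟩
  · rintro _ (⟨b, hb, rfl⟩ | ⟨_, ⟨b, hb, rfl⟩, rfl⟩)
    · simpa [θ, hb] using h b hb
    · simpa [θ, hb] using (h b hb).symm
  · rintro (a | c) hx
    · have : a ∉ B := by simpa using hx
      simp [θ, this]
    · have : ρ.symm c ∉ B := by
        intro hc
        exact hx (Or.inr ⟨c, ⟨_, hc, by simp⟩, rfl⟩)
      simp [θ, this]

theorem HasEdgePerm.sum {K : SimpleGraph (V₁ ⊕ V₂)} {K₁ : SimpleGraph V₁} {K₂ : SimpleGraph V₂}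
    {A₁ : Set V₁} {A₂ : Set V₂} (h₁ : HasEdgePerm K₁ A₁) (h₂ : HasEdgePerm K₂ A₂)
    (hK₁ : ∀ a b, K₁.Adj a b → K.Adj (Sum.inl a) (Sum.inl b))
    (hK₂ : ∀ a b, K₂.Adj a b → K.Adj (Sum.inr a) (Sum.inr b)) :
    HasEdgePerm K (Sum.inl '' A₁ ∪ Sum.inr '' A₂) := by
  obtain ⟨π, hπ, hπ'⟩ := h₁
  obtain ⟨θ, hθ, hθ'⟩ := h₂
  refine ⟨Perm.sumCongr π θ, ?_, ?_⟩
  · rintro _ (⟨a, ha, rfl⟩ | ⟨a, ha, rfl⟩)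
    · exact hK₁ _ _ (hπ a ha)
    · exact hK₂ _ _ (hθ a ha)
  · rintro (a | a) ha
    · simp [hπ' a (by simpa using ha)]
    · simp [hθ' a (by simpa using ha)]

/-- If the left half is coverable after giving up `B`, and one of the two matchings has no fault
at `B`, then the vertices of `B` are matched across, and robustness covers the rest of the right
half. -/
theorem hasEdgePerm_join_of_cross [DecidableEq V₁] [DecidableEq V₂] (S : Finset (V₁ ⊕ V₂))
    (T : Finset (Sym2 (V₁ ⊕ V₂))) (ρ : V₁ ≃ V₂) (hρ : ρ = σ ∨ ρ = τ) {k : ℕ} (h₂ : Robust G₂ k)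
    (B : Finset V₁)
    (h₁ : HasEdgePerm (G₁.deleteEdges (leftEdges T : Set (Sym2 V₁)))
      ((S.toLeft ∪ B : Finset V₁) : Set V₁)ᶜ)
    (hB : ∀ b ∈ B, ρ b ∉ S.toRight ∧ s(Sum.inl b, Sum.inr (ρ b)) ∉ T)
    (hk : S.toRight.card + (rightEdges T).card + B.card ≤ k) :
    HasEdgePerm ((twoMatchingJoin G₁ G₂ σ τ).deleteEdges (T : Set (Sym2 (V₁ ⊕ V₂))))
      (S : Set (V₁ ⊕ V₂))ᶜ := by
  -- vertices of `B` that are deleted anyway need no partner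
  set C := B \ S.toLeft with hC
  have hCB : C ⊆ B := Finset.sdiff_subset
  have hcard : (C.image ρ).card ≤ B.card := Finset.card_image_le.trans (Finset.card_le_card hCB)
  have e₂ := h₂ (S.toRight ∪ C.image ρ) (rightEdges T) (by
    have := Finset.card_union_le S.toRight (C.image ρ)
    omega)
  have hsum := h₁.sum (K := (twoMatchingJoin G₁ G₂ σ τ).deleteEdges (T : Set (Sym2 (V₁ ⊕ V₂))))
    e₂ (by
      intro a b hab
      rw [SimpleGraph.deleteEdges_adj] at hab ⊢
      exact ⟨hab.1, fun h => hab.2 (mem_leftEdges.2 h)⟩) (by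
      intro a b hab
      rw [SimpleGraph.deleteEdges_adj] at hab ⊢
      exact ⟨hab.1, fun h => hab.2 (mem_rightEdges.2 h)⟩)
  have hcross := HasEdgePerm.cross
    (K := (twoMatchingJoin G₁ G₂ σ τ).deleteEdges (T : Set (Sym2 (V₁ ⊕ V₂)))) ρ (C : Set V₁) (by
      intro b hb
      rw [SimpleGraph.deleteEdges_adj]
      refine ⟨?_, (hB b (hCB hb)).2⟩
      rcases hρ with rfl | rfl
      · exact Or.inl rfl
      · exact Or.inr rfl)
  convert hsum.union hcross ?_ using 1
  · ext x
    rcases x with a | c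
    · simp [hC]
      tauto
    · have : ρ.symm c ∈ C → Sum.inr c ∉ S := fun hc => by
        simpa using (hB _ (hCB hc)).1
      simp
      tauto
  · rw [Set.disjoint_left]
    rintro (a | c) h h'
    · simp [hC] at h h'
      tauto
    · simp at h h'
      tauto

/-- Covering the join when the right half has at most `k` faults, so that a surplus of faults can
only occur in the left half. -/
theorem hasEdgePerm_join_of_right_le [Finite V₁] (hστ : ∀ v, σ v ≠ τ v) {k : ℕ} (hk : 4 ≤ k)
    (h₁ : Robust G₁ k) (h₂ : Robust G₂ k) (S : Finset (V₁ ⊕ V₂)) (T : Finset (Sym2 (V₁ ⊕ V₂)))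
    (hST : S.card + T.card ≤ k + 2) (hright : S.toRight.card + (rightEdges T).card ≤ k) :
    HasEdgePerm ((twoMatchingJoin G₁ G₂ σ τ).deleteEdges (T : Set (Sym2 (V₁ ⊕ V₂))))
      (S : Set (V₁ ⊕ V₂))ᶜ := by
  classical
  have hS : S.toLeft.card + S.toRight.card = S.card := Finset.card_toLeft_add_card_toRight
  have hT := card_leftEdges_add T
  by_cases hl0 : S.toLeft.card + (leftEdges T).card ≤ k
  · refine hasEdgePerm_join_of_cross S T σ (Or.inl rfl) h₂ ∅ ?_ (by simp) (by simpa using hright)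
    simpa using h₁ _ _ hl0
  by_cases hl1 : S.toLeft.card + (leftEdges T).card = k + 1
  swap
  -- all `k + 2` faults lie in the left half
  · obtain ⟨B, hB, h⟩ := h₁.exists_repair 2 S.toLeft (leftEdges T) (by omega)
    refine hasEdgePerm_join_of_cross S T σ (Or.inl rfl) h₂ B h (fun b _ => ⟨?_, ?_⟩) (by omega)
    · rw [Finset.card_eq_zero.1 (by omega : S.toRight.card = 0)]
      simp
    · rw [← mem_crossEdges, Finset.card_eq_zero.1 (by omega : (crossEdges T).card = 0)]
      simp
  -- `k + 1` faults in the left half, hence at most one fault elsewhere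
  rcases S.toRight.eq_empty_or_nonempty with hr | ⟨w, hw⟩
  · obtain ⟨B, hB, h⟩ := h₁.exists_repair 1 S.toLeft (leftEdges T) (by omega)
    -- a single faulty cross edge spoils only one of `σ` and `τ`, since they are disjoint
    by_cases hσ : ∀ b ∈ B, s(Sum.inl b, Sum.inr (σ b)) ∉ T
    · exact hasEdgePerm_join_of_cross S T σ (Or.inl rfl) h₂ B h
        (fun b hb => ⟨by simp [hr], hσ b hb⟩) (by omega)
    refine hasEdgePerm_join_of_cross S T τ (Or.inr rfl) h₂ B h
      (fun b hb => ⟨by simp [hr], fun hτ => ?_⟩) (by omega)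
    push Not at hσ
    obtain ⟨b', -, hb'⟩ := hσ
    have := Finset.card_le_one.1 (by omega : (crossEdges T).card ≤ 1) _ (mem_crossEdges.2 hτ) _
      (mem_crossEdges.2 hb')
    simp at this
    obtain ⟨rfl, h'⟩ := this
    exact hστ _ h'.symm
  -- the other fault is the vertex `w`, which spoils `σ` on `B` only if `σ.symm w ∈ B`, and likewise
  -- for `τ`
  · have hpos := Finset.card_pos.2 ⟨w, hw⟩
    have hw1 : ∀ x ∈ S.toRight, x = w := fun x hx =>
      Finset.card_le_one.1 (by omega : S.toRight.card ≤ 1) _ hx _ hw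
    have hc : ∀ a b, s(Sum.inl a, Sum.inr b) ∉ T := by
      intro a b
      rw [← mem_crossEdges, Finset.card_eq_zero.1 (by omega : (crossEdges T).card = 0)]
      simp
    have hpq : σ.symm w ≠ τ.symm w := by
      intro h
      apply hστ (σ.symm w)
      rw [h, Equiv.apply_symm_apply, ← h, Equiv.apply_symm_apply]
    obtain ⟨B, hB, hp | hq, h⟩ := h₁.exists_repair_avoiding (by omega) S.toLeft (leftEdges T)
      hl1 hpq
    · refine hasEdgePerm_join_of_cross S T σ (Or.inl rfl) h₂ B h
        (fun b hb => ⟨fun hbS => hp ?_, hc _ _⟩) (by omega)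
      rwa [← hw1 _ hbS, Equiv.symm_apply_apply]
    · refine hasEdgePerm_join_of_cross S T τ (Or.inr rfl) h₂ B h
        (fun b hb => ⟨fun hbS => hq ?_, hc _ _⟩) (by omega)
      rwa [← hw1 _ hbS, Equiv.symm_apply_apply]

/-- Interchanging the two halves replaces the matchings by their inverses. -/
def joinSwap (G₁ : SimpleGraph V₁) (G₂ : SimpleGraph V₂) (σ τ : V₁ ≃ V₂) :
    twoMatchingJoin G₂ G₁ σ.symm τ.symm ≃g twoMatchingJoin G₁ G₂ σ τ where
  toEquiv := Equiv.sumComm V₂ V₁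
  map_rel_iff' := by
    rintro (a | a) (b | b)
    · rfl
    · exact or_congr (σ.symm_apply_eq.trans eq_comm).symm (τ.symm_apply_eq.trans eq_comm).symm
    · exact or_congr (σ.symm_apply_eq.trans eq_comm).symm (τ.symm_apply_eq.trans eq_comm).symm
    · rfl

theorem Robust.join [Finite V₁] (hστ : ∀ v, σ v ≠ τ v) {k : ℕ} (hk : 4 ≤ k)
    (h₁ : Robust G₁ k) (h₂ : Robust G₂ k) : Robust (twoMatchingJoin G₁ G₂ σ τ) (k + 2) := by
  intro S T hST
  by_cases hright : S.toRight.card + (rightEdges T).card ≤ k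
  · exact hasEdgePerm_join_of_right_le hστ hk h₁ h₂ S T hST hright
  have hS : S.toLeft.card + S.toRight.card = S.card := Finset.card_toLeft_add_card_toRight
  have hT := card_leftEdges_add T
  have := Finite.of_equiv _ σ
  refine hasEdgePerm_iso (joinSwap G₁ G₂ σ τ) (hasEdgePerm_join_of_right_le ?_ hk h₂ h₁ _ _ ?_ ?_)
  · intro v h
    apply hστ (σ.symm v)
    rw [Equiv.apply_symm_apply, h, Equiv.apply_symm_apply]
  · classical
    rw [Finset.card_preimage, Finset.card_preimage]
    have h1 := Finset.card_filter_le S (· ∈ Set.range (joinSwap G₁ G₂ σ τ))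
    have h2 := Finset.card_filter_le T (· ∈ Set.range (Sym2.map (joinSwap G₁ G₂ σ τ)))
    omega
  · have e1 : (S.preimage (joinSwap G₁ G₂ σ τ)
        (joinSwap G₁ G₂ σ τ).injective.injOn).toRight = S.toLeft := by
      ext x
      simp [joinSwap]
    have e2 : rightEdges (T.preimage (Sym2.map (joinSwap G₁ G₂ σ τ))
        (Sym2.map.injective (joinSwap G₁ G₂ σ τ).injective).injOn) = leftEdges T := by
      ext e
      induction e with
      | _ x y => simp [mem_rightEdges, mem_leftEdges, joinSwap]
    rw [e1, e2]
    omega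

end Join

/-! ### Regularity -/

theorem ncard_neighborSet_iso {V W : Type*} {G : SimpleGraph V} {H : SimpleGraph W} (e : G ≃g H)
    {d : ℕ} (h : ∀ v, (G.neighborSet v).ncard = d) (w : W) : (H.neighborSet w).ncard = d := by
  obtain ⟨v, rfl⟩ := e.surjective w
  rw [← h v, ← Set.ncard_image_of_injective _ e.injective]
  congr 1
  ext x
  obtain ⟨x, rfl⟩ := e.surjective x
  simpa using e.map_adj_iff

theorem ncard_neighborSet_join {V₁ V₂ : Type u} [Finite V₁] [Finite V₂] {G₁ : SimpleGraph V₁}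
    {G₂ : SimpleGraph V₂} {σ τ : V₁ ≃ V₂} (hστ : ∀ v, σ v ≠ τ v) {d : ℕ}
    (h₁ : ∀ v, (G₁.neighborSet v).ncard = d) (h₂ : ∀ v, (G₂.neighborSet v).ncard = d)
    (x : V₁ ⊕ V₂) : ((twoMatchingJoin G₁ G₂ σ τ).neighborSet x).ncard = d + 2 := by
  rcases x with a | c
  · have : (twoMatchingJoin G₁ G₂ σ τ).neighborSet (Sum.inl a) =
        Sum.inl '' G₁.neighborSet a ∪ {Sum.inr (σ a), Sum.inr (τ a)} := by
      ext (b | b) <;> simp [twoMatchingJoin, eq_comm]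
    rw [this, Set.ncard_union_eq (by simp [Set.disjoint_left]),
      Set.ncard_image_of_injective _ Sum.inl_injective, h₁, Set.ncard_pair (by simpa using hστ a)]
  · have : (twoMatchingJoin G₁ G₂ σ τ).neighborSet (Sum.inr c) =
        Sum.inr '' G₂.neighborSet c ∪ {Sum.inl (σ.symm c), Sum.inl (τ.symm c)} := by
      ext (b | b) <;> simp [twoMatchingJoin, Equiv.eq_symm_apply]
    have hne : σ.symm c ≠ τ.symm c := by
      intro h
      apply hστ (σ.symm c)
      rw [h, Equiv.apply_symm_apply, ← h, Equiv.apply_symm_apply]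
    rw [this, Set.ncard_union_eq (by simp [Set.disjoint_left]),
      Set.ncard_image_of_injective _ Sum.inr_injective, h₂, Set.ncard_pair (by simpa using hne)]

/-- Complementation of binary strings. -/
def complEquiv (n : ℕ) : (Fin n → Bool) ≃ (Fin n → Bool) :=
  Equiv.piCongrRight fun _ => Equiv.boolNot

/-- The recursive step of the augmented cubes is the join by the identity and complementation. -/
def augmentedCubeSucc (n : ℕ) :
    twoMatchingJoin (augmentedCube n) (augmentedCube n) (Equiv.refl _) (complEquiv n) ≃g
      augmentedCube (n + 1) where
  toFun := Sum.elim (Fin.cons (α := fun _ => Bool) false) (Fin.cons (α := fun _ => Bool) true)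
  invFun u := if u 0 then Sum.inr (Fin.tail u) else Sum.inl (Fin.tail u)
  left_inv := by rintro (a | a) <;> simp
  right_inv u := by
    cases h : u 0 <;> simp [h] <;> rw [← h, Fin.cons_self_tail]
  map_rel_iff' := by
    have hc : ∀ a b : Fin n → Bool, complEquiv n a = b ↔ ∀ i, a i ≠ b i := by
      intro a b
      simp [complEquiv, funext_iff, Bool.eq_not, Pi.map]
    rintro (a | a) (b | b)
    · simp [twoMatchingJoin, augmentedCube]
    · simp [twoMatchingJoin, augmentedCube, hc]
    · have h1 : a = b ↔ b = a := eq_comm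
      have h2 : ∀ i, a i = b i ↔ b i = a i := fun i => eq_comm
      simp [twoMatchingJoin, augmentedCube, hc, h1, h2]
    · simp [twoMatchingJoin, augmentedCube]

theorem ncard_neighborSet_augmentedCube (n : ℕ) (u : Fin (n + 1) → Bool) :
    ((augmentedCube (n + 1)).neighborSet u).ncard = 2 * n + 1 := by
  induction n with
  | zero =>
    -- for strings of length `0` the identity and the complementation coincide, so `AQ_1` is not a
    -- join by disjoint matchings
    rw [Set.ncard_eq_one]
    refine ⟨fun _ => !u 0, ?_⟩
    ext v
    simpa [augmentedCube, funext_iff, Bool.eq_not] using not_congr eq_comm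
  | succ n ih =>
    refine ncard_neighborSet_iso (augmentedCubeSucc (n + 1)) (d := 2 * n + 1 + 2)
      (ncard_neighborSet_join (fun v h => ?_) ih ih) u
    have := congrFun h 0
    simp [complEquiv] at this

theorem IsGAQ.finite_nonempty_ncard {n : ℕ} {V : Type u} {G : SimpleGraph V} (h : IsGAQ n G) :
    4 ≤ n ∧ Finite V ∧ Nonempty V ∧ ∀ v, (G.neighborSet v).ncard = 2 * n - 1 := by
  induction h with
  | base e =>
    exact ⟨le_rfl, Finite.of_equiv _ e.toEquiv, e.toEquiv.symm.nonempty,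
      ncard_neighborSet_iso e (ncard_neighborSet_augmentedCube 3)⟩
  | @step n V₁ V₂ V G₁ G₂ G h₁ h₂ σ τ hστ e ih₁ ih₂ =>
    obtain ⟨hn, _, _, hd₁⟩ := ih₁
    obtain ⟨-, _, _, hd₂⟩ := ih₂
    refine ⟨by omega, Finite.of_equiv _ e.toEquiv, e.toEquiv.symm.nonempty, fun v => ?_⟩
    rw [ncard_neighborSet_iso e (ncard_neighborSet_join hστ hd₁ hd₂)]
    omega

/-- The definition of `fsmp` concerns sets of edges of `G`; pairs in `T` that are not edges play no
role. -/
theorem robust_of_lt_fsmp {V : Type u} [Fintype V] {G : SimpleGraph V} {k : ℕ}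
    (h : k < fsmp G) : Robust G k := by
  classical
  intro S T hST
  have key : HasEdgePerm (G.deleteEdges ((T.filter (· ∈ G.edgeSet) : Finset _) : Set (Sym2 V)))
      (S : Set V)ᶜ := by
    rw [← exists_isFractionalPerfectMatching_iff]
    by_contra hno
    have hle : fsmp G ≤ S.card + (T.filter (· ∈ G.edgeSet)).card :=
      Nat.sInf_le ⟨S, T.filter (· ∈ G.edgeSet), ⟨fun e he => by
        simpa using (Finset.mem_filter.1 he).2, by convert hno⟩, rfl⟩
    have := Finset.card_filter_le T (· ∈ G.edgeSet)
    omega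
  refine key.mono fun x y hxy => ?_
  rw [SimpleGraph.deleteEdges_adj] at hxy ⊢
  exact ⟨hxy.1, fun hT => hxy.2 (by simpa using ⟨hT, hxy.1⟩)⟩

open Classical in
theorem isFSMPSet_incidenceFinset {V : Type u} [Fintype V] (G : SimpleGraph V) (v : V) :
    IsFSMPSet G ∅ (G.incidenceFinset v) := by
  refine ⟨by simpa using G.incidenceSet_subset v, ?_⟩
  rw [exists_isFractionalPerfectMatching_iff]
  rintro ⟨π, hπ, -⟩
  have := hπ v (by simp)
  rw [SimpleGraph.deleteEdges_adj] at this
  exact this.2 (by simpa [SimpleGraph.mk'_mem_incidenceSet_iff] using this.1)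

open Classical in
theorem fsmp_eq_of_robust {V : Type u} [Fintype V] {G : SimpleGraph V} {k : ℕ} {v : V}
    (h : Robust G k) (hv : G.degree v = k + 1) : fsmp G = k + 1 := by
  have hmem : k + 1 ∈ {k : ℕ | ∃ (S : Finset V) (T : Finset (Sym2 V)),
      IsFSMPSet G S T ∧ S.card + T.card = k} :=
    ⟨∅, _, isFSMPSet_incidenceFinset G v, by simp [hv]⟩
  refine le_antisymm (Nat.sInf_le hmem) (le_csInf ⟨_, hmem⟩ ?_)
  rintro _ ⟨S, T, hF, rfl⟩
  by_contra! hlt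
  exact hF.2 ((exists_isFractionalPerfectMatching_iff G S T).2 (h S T (by omega)))

end AugCube

theorem theorem3p2 (n : ℕ) (hn : 5 ≤ n)
    (ih : ∀ (W : Type u) [Fintype W] (H : SimpleGraph W),
      AugCube.IsGAQ (n - 1) H → AugCube.fsmp H = 2 * n - 3) :
    ∀ (V : Type u) [Fintype V] (G : SimpleGraph V), AugCube.IsGAQ n G →
      AugCube.fsmp G = 2 * n - 1 ∧ AugCube.IsFractionalStronglyMaximallyMatched G := by
  classical
  intro V _ G hG
  obtain ⟨-, -, hne, hdeg⟩ := hG.finite_nonempty_ncard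
  have hreg : G.IsRegularOfDegree (2 * n - 1) := fun v => by
    rw [← hdeg v, Set.ncard_eq_toFinset_card', ← SimpleGraph.card_neighborFinset_eq_degree,
      SimpleGraph.neighborFinset_def]
  have hrob : AugCube.Robust G (2 * n - 4 + 2) := by
    cases hG with
    | base e => omega
    | @step m V₁ V₂ _ G₁ G₂ _ h₁ h₂ σ τ hστ e =>
      -- each half withstands `2 n - 4` deletions, one fewer than its preclusion number
      obtain ⟨-, hfin₁, -⟩ := h₁.finite_nonempty_ncard
      obtain ⟨-, hfin₂, -⟩ := h₂.finite_nonempty_ncard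
      have := Fintype.ofFinite V₁
      have := Fintype.ofFinite V₂
      have e₁ := ih V₁ G₁ h₁
      have e₂ := ih V₂ G₂ h₂
      exact (AugCube.Robust.join hστ (by omega) (AugCube.robust_of_lt_fsmp (by omega))
        (AugCube.robust_of_lt_fsmp (by omega))).map e
  obtain ⟨v⟩ := hne
  have hfsmp : AugCube.fsmp G = 2 * n - 1 := by
    rw [AugCube.fsmp_eq_of_robust hrob (v := v) (by rw [hreg v]; omega)]
    omega
  refine ⟨hfsmp, ?_⟩
  have : Nonempty V := ⟨v⟩
  rw [AugCube.IsFractionalStronglyMaximallyMatched, hfsmp]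
  exact (hreg.minDegree_eq).symm
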